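/- Let $n \ge 0$ and let $\ell_1^n$ be $\mathbb{R}^n$ with the metric $d(x,y)=\sum_i |x_i-y_i|$. For a finite set $B$ of points of a metric space, a weighting is a vector $w\in\mathbb{R}^B$ with $\sum_{b\in B} e^{-d(a,b)}w_b=1$ for all $a\in B$, and the magnitude of $B$ is $|B|=\sum_{b\in B} w_b$ for any weighting $w$ (with $|\emptyset|=0$). A subset $A$ of a metric space is positive definite if the matrix $(e^{-d(a,b)})_{a,b\in B}$ is positive definite for every finite $B\subseteq A$; the magnitude of a compact positive definite $A$ is $|A|=\sup\{|B| : B\subseteq A \text{ finite}\}\in[0,\infty]$. Call $A\subseteq\ell_1^n$ $\ell_1$-convex if for all $a,b\in A$ there is a distance-preserving map $\gamma:[0,d(a,b)]\to A$ with $\gamma(0)=a$ and $\gamma(d(a,b))=b$. Call $A$ pixelated if $A=\lambda U$ for some real $\lambda>0$ and some finite union $U$ of unit lattice cubes $\prod_{i=1}^n[a_i,a_i+1]$ with $a_i\in\mathbb{Z}$. Let $A\subseteq\ell_1^n$ be pixelated and $\ell_1$-convex. Then $A$ is positive definite; there are unique real numbers $V'_0(A),\dots,V'_n(A)$, the $\ell_1$-intrinsic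 volumes of $A$, such that $$\mathrm{vol}\bigl(A+r[-\tfrac12,\tfrac12]^n\bigr)=\sum_{i=0}^n V'_i(A)\,r^{n-i}\qquad\text{for all } r\ge 0,$$ where $\mathrm{vol}$ is $n$-dimensional Lebesgue measure; and $$|A|=\sum_{i=0}^n 2^{-i}\,V'_i(A).$$ -/

import Mathlib

open scoped Pointwise

noncomputable section

namespace L1Magnitude

section Magnitude

variable {X : Type*} [MetricSpace X]

/-- The similarity matrix `Z(a, b) = exp (-d(a, b))` of a finite set of points. -/
def similarityMatrix (B : Finset X) : Matrix B B ℝ :=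
  Matrix.of fun a b => Real.exp (-dist (a : X) (b : X))

/-- A weighting on a finite set of points: `∑ b, Z(a, b) w_b = 1` for every `a`. -/
def IsWeighting (B : Finset X) (w : B → ℝ) : Prop :=
  ∀ a : B, ∑ b : B, similarityMatrix B a b * w b = 1

/-- All weightings on a finite metric space have the same total weight. -/
theorem IsWeighting.sum_eq {B : Finset X} {w v : B → ℝ} (hw : IsWeighting B w)
    (hv : IsWeighting B v) : ∑ b, w b = ∑ b, v b := by
  have h1 : ∑ b, w b = ∑ b, ∑ a, w b * (similarityMatrix B b a * v a) := by
    refine Finset.sum_congr rfl fun b _ => ?_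
    rw [← Finset.mul_sum, hv b, mul_one]
  have h2 : ∑ a, v a = ∑ a, ∑ b, w b * (similarityMatrix B b a * v a) := by
    refine Finset.sum_congr rfl fun a _ => ?_
    have : ∀ b, w b * (similarityMatrix B b a * v a)
        = similarityMatrix B a b * w b * v a := by
      intro b
      simp only [similarityMatrix, Matrix.of_apply, dist_comm (a : X) (b : X)]
      ring
    simp_rw [this]
    rw [← Finset.sum_mul, hw a, one_mul]
  rw [h1, h2, Finset.sum_comm]

open Classical in
/-- The magnitude of a finite set of points: the total weight of any weighting
(and `0` in case there is no weighting). -/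
def finiteMagnitude (B : Finset X) : ℝ :=
  if h : ∃ w : B → ℝ, IsWeighting B w then ∑ b, h.choose b else 0

/-- A subspace is positive definite if the similarity matrix of each of its finite subsets
is positive definite. -/
def IsPositiveDefinite (A : Set X) : Prop :=
  ∀ B : Finset X, (B : Set X) ⊆ A → (similarityMatrix B).PosDef

/-- The magnitude of a compact positive definite subspace: the supremum of the magnitudes
of its finite subsets. -/
def magnitude (A : Set X) : EReal :=
  ⨆ (B : Finset X) (_ : (B : Set X) ⊆ A), (finiteMagnitude B : EReal)

/-- A subspace is geodesic if any two of its points `a`, `b` are joined, inside it, by a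
distance-preserving map from the interval `[0, d(a, b)]`. -/
def IsGeodesic (A : Set X) : Prop :=
  ∀ a ∈ A, ∀ b ∈ A, ∃ γ : ℝ → X, γ 0 = a ∧ γ (dist a b) = b ∧
    (∀ s ∈ Set.Icc 0 (dist a b), γ s ∈ A) ∧
    ∀ s ∈ Set.Icc 0 (dist a b), ∀ t ∈ Set.Icc 0 (dist a b), dist (γ s) (γ t) = dist s t

end Magnitude

/-- The space `ℓ₁ⁿ`: `ℝⁿ` with the metric `∑ i, |x i - y i|`. -/
abbrev L1Space (n : ℕ) : Type := PiLp 1 (fun _ : Fin n => ℝ)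

/-- The unit lattice cube `∏ i, [a i, a i + 1]`. -/
def pixel {n : ℕ} (a : Fin n → ℤ) : Set (L1Space n) :=
  {x | ∀ i, x i ∈ Set.Icc (a i : ℝ) (a i + 1)}

/-- A set is pixelated if it is `c • U` with `c > 0` and `U` a finite union of pixels. -/
def IsPixelated {n : ℕ} (A : Set (L1Space n)) : Prop :=
  ∃ c : ℝ, 0 < c ∧ ∃ F : Finset (Fin n → ℤ), A = c • ⋃ a ∈ F, pixel a

/-- The cube `[-1/2, 1/2]ⁿ`. -/
def cube (n : ℕ) : Set (L1Space n) :=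
  {x | ∀ i, x i ∈ Set.Icc (-(1 / 2) : ℝ) (1 / 2)}

/-- `n`-dimensional Lebesgue measure of a subset of `ℓ₁ⁿ`. -/
def vol {n : ℕ} (A : Set (L1Space n)) : ℝ :=
  MeasureTheory.volume.real ((fun x : L1Space n => (fun i => x i : Fin n → ℝ)) '' A)

/-- `V 0, …, V n` are the coefficients of the Steiner polynomial of `A` with respect to
cubes. -/
def IsSteinerCoeff {n : ℕ} (A : Set (L1Space n)) (V : Fin (n + 1) → ℝ) : Prop :=
  ∀ r : ℝ, 0 ≤ r → vol (A + r • cube n) = ∑ i : Fin (n + 1), V i * r ^ (n - (i : ℕ))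

/-- Steiner coefficients are unique. -/
theorem IsSteinerCoeff.unique {n : ℕ} {A : Set (L1Space n)} {V W : Fin (n + 1) → ℝ}
    (hV : IsSteinerCoeff A V) (hW : IsSteinerCoeff A W) : V = W := by
  let p : Polynomial ℝ := ∑ i : Fin (n + 1), Polynomial.monomial (n - (i : ℕ)) (V i - W i)
  have hp : p = 0 := by
    apply Polynomial.eq_zero_of_infinite_isRoot
    refine (Set.Ici_infinite (0 : ℝ)).mono fun r hr => ?_
    have := (hV r hr).symm.trans (hW r hr)
    simp only [Set.mem_ofPred_eq, Polynomial.IsRoot.def, p, Polynomial.eval_finsetSum,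
      Polynomial.eval_monomial, sub_mul, Finset.sum_sub_distrib]
    linarith
  funext j
  have hj := congrArg (fun q => Polynomial.coeff q (n - (j : ℕ))) hp
  simp only [p, Polynomial.finsetSum_coeff, Polynomial.coeff_monomial,
    Polynomial.coeff_zero] at hj
  rw [Finset.sum_eq_single j] at hj
  · simp only [if_true] at hj
    linarith
  · intro i _ hij
    rw [if_neg]
    intro h
    apply hij
    ext
    omega
  · simp

open Classical in
/-- The `ℓ₁`-intrinsic volumes `V'_0(A), …, V'_n(A)`: the coefficients of the Steiner
polynomial with respect to cubes (and `0` in case there is no such polynomial). -/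
def l1IntrinsicVolume {n : ℕ} (A : Set (L1Space n)) : Fin (n + 1) → ℝ :=
  if h : ∃ V : Fin (n + 1) → ℝ, IsSteinerCoeff A V then h.choose else 0

end L1Magnitude

end

/-!
Let `A ⊆ ℓ₁ⁿ` be pixelated and `ℓ₁`-convex. If `c` is the size of its pixels then, for every
`N > 0` and the mesh `ε = c / N`, `A` is a finite union of open faces of the grid `ε ℤⁿ`, and
everything is computed by sums over these faces.

The convexity of `A` enters through the Euler characteristic (`sum_prod_eulerFace`): a box `Q` that
meets `A` satisfies `χ(A ∩ Q) = 1`, where `χ(A ∩ Q)` is the sum over the faces `I` of `A` of the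
products of the Euler characteristics of the one-dimensional pieces `I_i ∩ Q_i`. This follows by
slicing: hyperplane sections inherit the weak form `IsBoxConnected` of convexity, and the sections
that meet `Q` form an interval.

Integrating `χ(A ∩ Q)` over two families of boxes gives two formulas.

* For the translates of `[-r/2, r/2]ⁿ` one obtains the volume of `A + [-r/2, r/2]ⁿ`, as a sum over
  faces in which every vertex direction contributes `r` and every edge direction `ε - r`
  (`volume_parallel_eq_sum`). This is a polynomial `P(r)`, whose coefficients are the
  `ℓ₁`-intrinsic volumes.
* For the boxes `∏ [a_i - s_i, a_i + s_i]` around a vertex `a` of `A`, weighted by `exp (-∑ s_i)`,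
  one obtains an explicit weighting of the finite set `B_N` of all vertices of `A`
  (`sum_faceWeight_exp_neg_dist`). Its total mass is again a sum over faces, equal to
  `P(r_N) / r_N ^ n` for `r_N = ε (e^ε + 1) / (e^ε - 1)` (`sum_prod_faceWeight_mul_pow`).

As `N → ∞`, `r_N → 2`, so that the magnitude of `B_N` tends to `P(2) / 2ⁿ = ∑ i, 2⁻ⁱ V'_i(A)`. This
bounds the magnitude of `A` from below. For the upper bound, a finite subset of `A` is rounded to
the grid and its weighting compared with that of `B_N`, by the positive semidefiniteness of
`exp (-d)` (`magnitude_eq_of_tendsto`). Positive definiteness holds for all subsets of `ℓ₁ⁿ`,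
because `exp (-|s - t|) = e^s e^t exp (-2 max(s, t))` and the last factor is a positive combination of
products `1[s ≤ u] 1[t ≤ u]` (`exists_sum_exp_neg_dist_eq`).
-/

open scoped Pointwise

namespace L1Magnitude

/-! ### Faces of the grid and their Euler characteristics -/

/-- The index of the open face of the grid `ε ℤ` containing `x`: it is `2 * m` at the vertex
`ε * m`, and `2 * m + 1` on the open edge between `ε * m` and `ε * (m + 1)`. -/
noncomputable def faceIndex (ε x : ℝ) : ℤ := ⌊x / ε⌋ + ⌈x / ε⌉

theorem two_mul_le_faceIndex {ε : ℝ} (hε : 0 < ε) {x : ℝ} {m : ℤ} :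
    2 * m ≤ faceIndex ε x ↔ ε * m ≤ x := by
  rw [faceIndex, mul_comm ε, ← le_div_iff₀ hε]
  constructor
  · intro h
    by_contra! hlt
    have h1 : ⌊x / ε⌋ < m := Int.floor_lt.2 hlt
    have h2 : ⌈x / ε⌉ ≤ m := Int.ceil_le.2 hlt.le
    omega
  · intro h
    have h1 : m ≤ ⌊x / ε⌋ := Int.le_floor.2 h
    have h2 : ⌊x / ε⌋ ≤ ⌈x / ε⌉ := Int.floor_le_ceil _
    omega

theorem faceIndex_le_two_mul {ε : ℝ} (hε : 0 < ε) {x : ℝ} {m : ℤ} :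
    faceIndex ε x ≤ 2 * m ↔ x ≤ ε * m := by
  rw [faceIndex, mul_comm ε, ← div_le_iff₀ hε]
  constructor
  · intro h
    by_contra! hlt
    have h1 : m < ⌈x / ε⌉ := Int.lt_ceil.2 hlt
    have h2 : m ≤ ⌊x / ε⌋ := Int.le_floor.2 hlt.le
    omega
  · intro h
    have h1 : ⌈x / ε⌉ ≤ m := Int.ceil_le.2 h
    have h2 : ⌊x / ε⌋ ≤ ⌈x / ε⌉ := Int.floor_le_ceil _
    omega

theorem faceIndex_center {ε : ℝ} (hε : 0 < ε) (j : ℤ) : faceIndex ε (ε * (j / 2)) = j := by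
  obtain ⟨m, rfl | rfl⟩ := Int.even_or_odd' j
  · apply le_antisymm
    · rw [faceIndex_le_two_mul hε]; push_cast; linarith
    · rw [two_mul_le_faceIndex hε]; push_cast; linarith
  · have h1 : faceIndex ε (ε * ((2 * m + 1 : ℤ) / 2)) ≤ 2 * (m + 1) := by
      rw [faceIndex_le_two_mul hε]; push_cast; nlinarith
    have h2 : 2 * m ≤ faceIndex ε (ε * ((2 * m + 1 : ℤ) / 2)) := by
      rw [two_mul_le_faceIndex hε]; push_cast; nlinarith
    have h3 : ¬ faceIndex ε (ε * ((2 * m + 1 : ℤ) / 2)) ≤ 2 * m := by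
      rw [faceIndex_le_two_mul hε]; push_cast; nlinarith
    have h4 : ¬ 2 * (m + 1) ≤ faceIndex ε (ε * ((2 * m + 1 : ℤ) / 2)) := by
      rw [two_mul_le_faceIndex hε]; push_cast; nlinarith
    omega

theorem faceIndex_vertex {ε : ℝ} (hε : 0 < ε) (m : ℤ) : faceIndex ε (ε * m) = 2 * m := by
  have := faceIndex_center hε (2 * m)
  push_cast at this
  rwa [mul_div_cancel_left₀ _ (two_ne_zero' ℝ)] at this

theorem exists_eq_vertex_or_faceIndex_eq {ε : ℝ} (hε : 0 < ε) (t : ℝ) :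
    (∃ m : ℤ, t = ε * m) ∨
      ∃ a < t, ∃ b > t, faceIndex ε a = faceIndex ε t ∧ faceIndex ε b = faceIndex ε t := by
  obtain ⟨m, hm | hm⟩ := Int.even_or_odd' (faceIndex ε t)
  · exact .inl ⟨m, le_antisymm ((faceIndex_le_two_mul hε).1 hm.le)
      ((two_mul_le_faceIndex hε).1 hm.ge)⟩
  · have h1 : ε * m < t := by
      by_contra! h
      have := (faceIndex_le_two_mul hε).2 h
      omega
    have h2 : t < ε * (m + 1 : ℤ) := by
      by_contra! h
      have := (two_mul_le_faceIndex hε).2 h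
      omega
    have h3 : ∀ s, ε * m < s → s < ε * (m + 1 : ℤ) → faceIndex ε s = faceIndex ε t := by
      intro s hs hs'
      have h4 := (faceIndex_le_two_mul hε).not.2 hs.not_ge
      have h5 := (two_mul_le_faceIndex hε).not.2 hs'.not_ge
      omega
    obtain ⟨a, ha, hat⟩ := exists_between h1
    obtain ⟨b, htb, hb⟩ := exists_between h2
    exact .inr ⟨a, hat, b, htb, h3 a ha (hat.trans h2), h3 b (h1.trans htb) hb⟩

/-- The Euler characteristic of `[p, q] ∩ [u, v]`, for `p ≤ q` and `u ≤ v`. -/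
noncomputable def eulerIcc (u v p q : ℝ) : ℝ := if p ≤ v ∧ u ≤ q then 1 else 0

/-- The Euler characteristic (with compact supports) of `I ∩ [u, v]`, where `I` is the face of
the grid `ε ℤ` of index `k`. If `I` is an open edge then it is computed by additivity, removing
from the closed edge its two endpoints. -/
noncomputable def eulerFace (ε u v : ℝ) (k : ℤ) : ℝ :=
  if Even k then eulerIcc u v (ε * (k / 2 : ℤ)) (ε * (k / 2 : ℤ))
  else eulerIcc u v (ε * (k / 2 : ℤ)) (ε * ((k + 1) / 2 : ℤ))
    - eulerIcc u v (ε * (k / 2 : ℤ)) (ε * (k / 2 : ℤ))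
    - eulerIcc u v (ε * ((k + 1) / 2 : ℤ)) (ε * ((k + 1) / 2 : ℤ))

theorem eulerFace_vertex (ε u v : ℝ) (m : ℤ) :
    eulerFace ε u v (2 * m) = eulerIcc u v (ε * m) (ε * m) := by
  simp [eulerFace]

theorem eulerFace_edge (ε u v : ℝ) (m : ℤ) :
    eulerFace ε u v (2 * m + 1) = eulerIcc u v (ε * m) (ε * (m + 1 : ℤ))
      - eulerIcc u v (ε * m) (ε * m) - eulerIcc u v (ε * (m + 1 : ℤ)) (ε * (m + 1 : ℤ)) := by
  have h1 : ¬ Even (2 * m + 1) := by simp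
  have h2 : (2 * m + 1) / 2 = m := by omega
  have h3 : (2 * m + 1 + 1) / 2 = m + 1 := by omega
  rw [eulerFace, if_neg h1, h2, h3]

theorem sum_eulerFace_Icc {ε : ℝ} (hε : 0 < ε) {u v : ℝ} (huv : u ≤ v) {p q : ℤ} (hpq : p ≤ q) :
    ∑ k ∈ Finset.Icc (2 * p) (2 * q), eulerFace ε u v k = eulerIcc u v (ε * p) (ε * q) := by
  induction q, hpq using Int.leInduction with
  | base => simp [eulerFace_vertex]
  | succ q hpq ih =>
    have hs : Finset.Icc (2 * p) (2 * (q + 1))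
        = insert (2 * (q + 1)) (insert (2 * q + 1) (Finset.Icc (2 * p) (2 * q))) := by
      ext k
      simp only [Finset.mem_Icc, Finset.mem_insert]
      omega
    rw [hs, Finset.sum_insert, Finset.sum_insert, ih, eulerFace_vertex, eulerFace_edge]
    · have h1 : ε * p ≤ ε * q := by
        have : (p : ℝ) ≤ q := by exact_mod_cast hpq
        gcongr
      have h2 : ε * q < ε * (q + 1 : ℤ) := by push_cast; nlinarith
      generalize ε * (p : ℝ) = P at *
      generalize ε * (q : ℝ) = Q at *
      generalize ε * ((q + 1 : ℤ) : ℝ) = R at *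
      simp only [eulerIcc]
      grind
    · simp
    · simp only [Finset.mem_insert, Finset.mem_Icc]
      omega

/-- A nonempty compact interval that is a union of faces of the grid ends at vertices, so that its
Euler characteristic is that of a closed interval. -/
theorem sum_eulerFace_of_ordConnected {ε : ℝ} (hε : 0 < ε) {u v : ℝ} (huv : u ≤ v) (T : Finset ℤ)
    (hcomp : IsCompact {t : ℝ | faceIndex ε t ∈ T})
    (hconn : Set.OrdConnected {t : ℝ | faceIndex ε t ∈ T})
    [Decidable (∃ t, faceIndex ε t ∈ T ∧ u ≤ t ∧ t ≤ v)] :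
    ∑ k ∈ T, eulerFace ε u v k = if ∃ t, faceIndex ε t ∈ T ∧ u ≤ t ∧ t ≤ v then 1 else 0 := by
  rcases T.eq_empty_or_nonempty with rfl | ⟨j, hj⟩
  · simp
  have hne : {t : ℝ | faceIndex ε t ∈ T}.Nonempty :=
    ⟨ε * (j / 2), by simpa [faceIndex_center hε] using hj⟩
  obtain ⟨a, haT, ha⟩ := hcomp.exists_isLeast hne
  obtain ⟨b, hbT, hb⟩ := hcomp.exists_isGreatest hne
  obtain ⟨p, hp⟩ : ∃ p : ℤ, a = ε * p := by
    refine (exists_eq_vertex_or_faceIndex_eq hε a).resolve_right ?_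
    rintro ⟨s, hs, -, -, hsa, -⟩
    exact hs.not_ge (ha (by rwa [Set.mem_ofPred_eq, hsa]))
  obtain ⟨q, hq⟩ : ∃ q : ℤ, b = ε * q := by
    refine (exists_eq_vertex_or_faceIndex_eq hε b).resolve_right ?_
    rintro ⟨-, -, s, hs, -, hsb⟩
    exact hs.not_ge (hb (by rwa [Set.mem_ofPred_eq, hsb]))
  have hS : ∀ t, faceIndex ε t ∈ T ↔ a ≤ t ∧ t ≤ b := fun t =>
    ⟨fun h => ⟨ha h, hb h⟩, fun h => hconn.out haT hbT h⟩
  have hT : T = Finset.Icc (2 * p) (2 * q) := by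
    ext k
    rw [← faceIndex_center hε k, hS, Finset.mem_Icc, two_mul_le_faceIndex hε,
      faceIndex_le_two_mul hε, ← hp, ← hq]
  have hab : a ≤ b := ha hbT
  have hpq : p ≤ q := by
    rw [hp, hq] at hab
    exact_mod_cast le_of_mul_le_mul_left hab hε
  conv_lhs => rw [hT]
  rw [sum_eulerFace_Icc hε huv hpq, eulerIcc, ← hp, ← hq]
  refine if_congr ?_ rfl rfl
  simp only [hS]
  constructor
  · rintro ⟨h1, h2⟩
    exact ⟨max a u, ⟨le_max_left _ _, max_le hab h2⟩, le_max_right _ _, max_le h1 huv⟩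
  · rintro ⟨t, ⟨h1, h2⟩, h3, h4⟩
    exact ⟨h1.trans h4, h3.trans h2⟩

/-- Any two points `a`, `b` of `A` are connected, inside `A` and the box spanned by `a` and `b`,
through every intermediate value of every coordinate. This consequence of `ℓ₁`-convexity passes
to the sections of `A` by coordinate hyperplanes. -/
def IsBoxConnected {ι : Type*} (A : Set (ι → ℝ)) : Prop :=
  ∀ a ∈ A, ∀ b ∈ A, ∀ i, ∀ t ∈ Set.uIcc (a i) (b i),
    ∃ x ∈ A, x i = t ∧ ∀ j, x j ∈ Set.uIcc (a j) (b j)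

open Classical in
/-- A compact box-connected union of faces meets every box in a set of Euler characteristic `1`,
or not at all. By induction on the dimension: the sections by hyperplanes orthogonal to the first
axis have Euler characteristic `0` or `1`, and those that are nonempty form a compact interval. -/
theorem sum_prod_eulerFace {ε : ℝ} (hε : 0 < ε) {n : ℕ} (K : Finset (Fin n → ℤ))
    (hcomp : IsCompact {x : Fin n → ℝ | (fun i => faceIndex ε (x i)) ∈ K})
    (hconn : IsBoxConnected {x : Fin n → ℝ | (fun i => faceIndex ε (x i)) ∈ K})
    (u v : Fin n → ℝ) (huv : ∀ i, u i ≤ v i) :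
    ∑ k ∈ K, ∏ i, eulerFace ε (u i) (v i) (k i) =
      if ∃ x : Fin n → ℝ, (fun i => faceIndex ε (x i)) ∈ K ∧ ∀ i, u i ≤ x i ∧ x i ≤ v i
      then 1 else 0 := by
  induction n with
  | zero =>
    rcases K.eq_empty_or_nonempty with rfl | ⟨k, hk⟩
    · simp
    · have hK : K = {k} := Finset.eq_singleton_iff_unique_mem.2
        ⟨hk, fun x _ => Subsingleton.elim _ _⟩
      rw [if_pos ⟨0, by convert hk, fun i => i.elim0⟩, hK]
      simp
  | succ n ih =>
    let f : Fin n → ℤ → ℝ := fun i => eulerFace ε (u i.succ) (v i.succ)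
    let slice : ℤ → Finset (Fin n → ℤ) := fun j =>
      K.preimage (fun k => (Fin.cons j k : Fin (n + 1) → ℤ))
        (Fin.cons_right_injective (α := fun _ => ℤ) j).injOn
    have hsec : ∀ j k, k ∈ slice j ↔ (Fin.cons j k : Fin (n + 1) → ℤ) ∈ K := fun j k => by
      simp [slice]
    have hcons : ∀ (t : ℝ) (y : Fin n → ℝ),
        (fun i => faceIndex ε ((Fin.cons t y : Fin (n + 1) → ℝ) i))
          = (Fin.cons (faceIndex ε t) (fun i => faceIndex ε (y i)) : Fin (n + 1) → ℤ) := by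
      intro t y
      funext i
      refine Fin.cases ?_ (fun i => ?_) i <;> simp
    let T : Finset ℤ := (K.image fun k => k 0).filter fun j =>
      ∃ y : Fin n → ℝ, (fun i => faceIndex ε (y i)) ∈ slice j ∧
        ∀ i, u i.succ ≤ y i ∧ y i ≤ v i.succ
    have hT : ∀ j, j ∈ T ↔ ∃ y : Fin n → ℝ, (fun i => faceIndex ε (y i)) ∈ slice j ∧
        ∀ i, u i.succ ≤ y i ∧ y i ≤ v i.succ := by
      intro j
      simp only [T, Finset.mem_filter, and_iff_right_iff_imp, Finset.mem_image]
      rintro ⟨y, hy, -⟩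
      exact ⟨_, (hsec _ _).1 hy, by simp⟩
    have hTreal : {t : ℝ | faceIndex ε t ∈ T} = (fun x : Fin (n + 1) → ℝ => x 0) ''
        ({x | (fun i => faceIndex ε (x i)) ∈ K} ∩
          ⋂ i : Fin n, {x | u i.succ ≤ x i.succ ∧ x i.succ ≤ v i.succ}) := by
      ext t
      simp only [Set.mem_ofPred_eq, hT, hsec, ← hcons, Set.mem_image, Set.mem_inter_iff,
        Set.mem_iInter]
      constructor
      · rintro ⟨y, hy, hy'⟩
        exact ⟨Fin.cons t y, ⟨hy, by simpa using hy'⟩, by simp⟩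
      · rintro ⟨x, ⟨hx, hx'⟩, rfl⟩
        exact ⟨Fin.tail x, by simpa using hx, hx'⟩
    have hTcomp : IsCompact {t : ℝ | faceIndex ε t ∈ T} := by
      rw [hTreal]
      refine (hcomp.inter_right (isClosed_iInter fun i => ?_)).image (continuous_apply 0)
      exact (isClosed_le continuous_const (continuous_apply _)).inter
        (isClosed_le (continuous_apply _) continuous_const)
    have hTconn : Set.OrdConnected {t : ℝ | faceIndex ε t ∈ T} := by
      rw [hTreal, Set.ordConnected_iff_uIcc_subset]
      rintro _ ⟨x, ⟨hx, hx'⟩, rfl⟩ _ ⟨y, ⟨hy, hy'⟩, rfl⟩ t ht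
      obtain ⟨z, hz, rfl, hz'⟩ := hconn x hx y hy 0 t ht
      refine ⟨z, ⟨hz, ?_⟩, rfl⟩
      rw [Set.mem_iInter] at *
      exact fun i => Set.uIcc_subset_Icc (hx' i) (hy' i) (hz' i.succ)
    have hslice : ∀ j, ∑ k ∈ slice j, ∏ i, f i (k i) = if j ∈ T then 1 else 0 := by
      intro j
      have hpre : ∀ y : Fin n → ℝ, (fun i => faceIndex ε (y i)) ∈ slice j ↔
          (fun i => faceIndex ε ((Fin.cons (ε * (j / 2)) y : Fin (n + 1) → ℝ) i)) ∈ K := by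
        intro y
        rw [hcons, faceIndex_center hε, hsec]
      rw [ih (slice j) ?_ ?_ (fun i => u i.succ) (fun i => v i.succ) fun i => huv _]
      · simp only [hT]
      · have : {y : Fin n → ℝ | (fun i => faceIndex ε (y i)) ∈ slice j} =
            Fin.tail '' ({x | (fun i => faceIndex ε (x i)) ∈ K} ∩
              {x : Fin (n + 1) → ℝ | x 0 = ε * (j / 2)}) := by
          ext y
          simp only [Set.mem_ofPred_eq, hpre, Set.mem_image, Set.mem_inter_iff]
          constructor
          · intro h
            exact ⟨_, ⟨h, by simp⟩, by simp⟩
          · rintro ⟨x, ⟨hx, hx'⟩, rfl⟩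
            rw [← hx', Fin.cons_self_tail]
            exact hx
        rw [this]
        refine (hcomp.inter_right (isClosed_eq (continuous_apply 0) continuous_const)).image ?_
        exact continuous_pi fun i => continuous_apply _
      · intro a ha b hb i t ht
        rw [Set.mem_ofPred_eq, hpre] at ha hb
        obtain ⟨x, hx, hxt, hx'⟩ := hconn _ ha _ hb i.succ t (by simpa using ht)
        have hx0 : x 0 = ε * (j / 2) := by simpa using hx' 0
        refine ⟨Fin.tail x, ?_, hxt, fun i => by simpa [Fin.tail] using hx' i.succ⟩
        rw [Set.mem_ofPred_eq, hpre, ← hx0, Fin.cons_self_tail]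
        exact hx
    calc ∑ k ∈ K, ∏ i, eulerFace ε (u i) (v i) (k i)
        = ∑ j ∈ K.image (fun k => k 0), ∑ k ∈ K with k 0 = j,
            ∏ i, eulerFace ε (u i) (v i) (k i) :=
          (Finset.sum_fiberwise_of_maps_to (fun k hk => Finset.mem_image_of_mem _ hk) _).symm
      _ = ∑ j ∈ K.image (fun k => k 0), eulerFace ε (u 0) (v 0) j *
            ∑ k ∈ slice j, ∏ i, f i (k i) := by
          refine Finset.sum_congr rfl fun j _ => ?_
          rw [Finset.mul_sum]
          refine Finset.sum_nbij' Fin.tail (fun k => (Fin.cons j k : Fin (n + 1) → ℤ))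
            ?_ ?_ ?_ ?_ ?_
          · rintro k hk
            rw [Finset.mem_filter] at hk
            obtain ⟨hk, rfl⟩ := hk
            rw [hsec, Fin.cons_self_tail]
            exact hk
          · intro k hk
            rw [hsec] at hk
            simp [hk]
          · rintro k hk
            rw [Finset.mem_filter] at hk
            obtain ⟨hk, rfl⟩ := hk
            exact Fin.cons_self_tail _
          · intro k _
            simp
          · rintro k hk
            rw [Finset.mem_filter] at hk
            obtain ⟨hk, rfl⟩ := hk
            rw [Fin.prod_univ_succ]
            rfl
      _ = ∑ j ∈ T, eulerFace ε (u 0) (v 0) j := by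
          simp only [hslice, mul_ite, mul_one, mul_zero]
          rw [← Finset.sum_filter]
          refine Finset.sum_congr ?_ fun _ _ => rfl
          ext j
          simp [T]
      _ = _ := by
          rw [sum_eulerFace_of_ordConnected hε (huv 0) T hTcomp hTconn]
          refine if_congr ?_ rfl rfl
          simp only [hT, hsec, ← hcons]
          constructor
          · rintro ⟨t, ⟨y, hy, hy'⟩, ht⟩
            exact ⟨Fin.cons t y, hy, Fin.cases (by simpa using ht) (by simpa using hy')⟩
          · rintro ⟨x, hx, hx'⟩
            exact ⟨x 0, ⟨Fin.tail x, by simpa using hx, fun i => hx' i.succ⟩, hx' 0⟩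

open MeasureTheory

/-! ### Integrating Euler characteristics over families of boxes -/

theorem sum_prod_integral {n : ℕ} (K : Finset (Fin n → ℤ)) (f : Fin n → ℤ → ℝ → ℝ)
    (hf : ∀ i k, Integrable (f i k)) :
    ∑ k ∈ K, ∏ i, ∫ s, f i (k i) s = ∫ s : Fin n → ℝ, ∑ k ∈ K, ∏ i, f i (k i) (s i) := by
  rw [integral_finsetSum]
  · refine Finset.sum_congr rfl fun k _ => ?_
    rw [integral_fintype_prod_volume_eq_prod (fun i => f i (k i))]
  · exact fun k _ => Integrable.fintype_prod (f := fun i => f i (k i)) fun i => hf i (k i)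

theorem integral_sub_sub {f g h : ℝ → ℝ} (hf : Integrable f) (hg : Integrable g)
    (hh : Integrable h) :
    ∫ x, f x - g x - h x = (∫ x, f x) - (∫ x, g x) - ∫ x, h x := by
  rw [← integral_sub hf hg]
  exact integral_sub (hf.sub hg) hh

theorem eulerIcc_sub_add (r p q : ℝ) :
    (fun x => eulerIcc (x - r) (x + r) p q) = (Set.Icc (p - r) (q + r)).indicator 1 := by
  funext x
  simp only [eulerIcc, Set.indicator_apply, Set.mem_Icc, sub_le_iff_le_add, Pi.one_apply]

theorem integrable_eulerIcc_sub_add (r p q : ℝ) :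
    Integrable fun x => eulerIcc (x - r) (x + r) p q := by
  rw [eulerIcc_sub_add]
  exact (integrable_indicator_iff measurableSet_Icc).2 (integrableOn_const (by simp))

theorem integral_eulerIcc_sub_add {r p q : ℝ} (hr : 0 ≤ r) (hpq : p ≤ q) :
    ∫ x, eulerIcc (x - r) (x + r) p q = q - p + 2 * r := by
  rw [eulerIcc_sub_add, integral_indicator_one measurableSet_Icc, Real.volume_real_Icc_of_le]
  · ring
  · linarith

theorem integrable_eulerFace_sub_add (ε r : ℝ) (k : ℤ) :
    Integrable fun x => eulerFace ε (x - r) (x + r) k := by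
  unfold eulerFace
  split_ifs
  · exact integrable_eulerIcc_sub_add _ _ _
  · exact ((integrable_eulerIcc_sub_add _ _ _).sub (integrable_eulerIcc_sub_add _ _ _)).sub
      (integrable_eulerIcc_sub_add _ _ _)

/-- The one-dimensional Steiner polynomials of vertices and open edges. -/
theorem integral_eulerFace_sub_add {ε r : ℝ} (hε : 0 < ε) (hr : 0 ≤ r) (k : ℤ) :
    ∫ x, eulerFace ε (x - r / 2) (x + r / 2) k = if Even k then r else ε - r := by
  have hi := fun p q => integrable_eulerIcc_sub_add (r / 2) p q
  have hr' : 0 ≤ r / 2 := by linarith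
  obtain ⟨m, rfl | rfl⟩ := Int.even_or_odd' k
  · simp only [eulerFace_vertex]
    rw [integral_eulerIcc_sub_add hr' le_rfl, if_pos (even_two_mul m)]
    ring
  · have h1 : ε * m ≤ ε * (m + 1 : ℤ) := by push_cast; nlinarith
    simp only [eulerFace_edge]
    rw [integral_sub_sub (hi _ _) (hi _ _) (hi _ _),
      integral_eulerIcc_sub_add hr' le_rfl, integral_eulerIcc_sub_add hr' le_rfl,
      integral_eulerIcc_sub_add hr' h1, if_neg (by simp)]
    push_cast
    ring

/-- The density of the exponential distribution of rate `1`. -/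
noncomputable def expDensity (s : ℝ) : ℝ := (Set.Ici (0 : ℝ)).indicator (fun s => Real.exp (-s)) s

theorem expDensity_mul_eulerIcc {a p q d : ℝ} (hd : max (p - a) (a - q) = d) (hd0 : 0 ≤ d) :
    (fun s => expDensity s * eulerIcc (a - s) (a + s) p q) =
      (Set.Ici d).indicator fun s => Real.exp (-s) := by
  funext s
  have h : d ≤ s ↔ p ≤ a + s ∧ a - s ≤ q := by
    rw [← hd, max_le_iff, sub_le_iff_le_add', sub_le_comm]
  simp only [expDensity, eulerIcc, Set.indicator_apply, Set.mem_Ici, ← h]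
  split_ifs <;> first | rfl | (exfalso; linarith) | simp

theorem integrableOn_exp_neg_Ici (d : ℝ) : IntegrableOn (fun s => Real.exp (-s)) (Set.Ici d) := by
  rw [integrableOn_Ici_iff_integrableOn_Ioi]
  simpa using exp_neg_integrableOn_Ioi d one_pos

theorem integrable_expDensity_mul_eulerIcc (a p q : ℝ) :
    Integrable fun s => expDensity s * eulerIcc (a - s) (a + s) p q := by
  by_cases hd : 0 ≤ max (p - a) (a - q)
  · rw [expDensity_mul_eulerIcc rfl hd, integrable_indicator_iff measurableSet_Ici]
    exact integrableOn_exp_neg_Ici _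
  · have : (fun s => expDensity s * eulerIcc (a - s) (a + s) p q) = expDensity := by
      funext s
      rw [not_le, max_lt_iff] at hd
      simp only [expDensity, eulerIcc, Set.indicator_apply, Set.mem_Ici]
      split_ifs <;> first | rfl | (exfalso; grind) | simp
    rw [this]
    exact (integrable_indicator_iff measurableSet_Ici).2 (integrableOn_exp_neg_Ici 0)

theorem integral_expDensity_mul_eulerIcc {a p q d : ℝ} (hd : max (p - a) (a - q) = d)
    (hd0 : 0 ≤ d) : ∫ s, expDensity s * eulerIcc (a - s) (a + s) p q = Real.exp (-d) := by
  rw [expDensity_mul_eulerIcc hd hd0, integral_indicator measurableSet_Ici,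
    integral_Ici_eq_integral_Ioi, integral_exp_neg_Ioi]

theorem integral_expDensity : ∫ s, expDensity s = 1 := by
  unfold expDensity
  rw [integral_indicator measurableSet_Ici, integral_Ici_eq_integral_Ioi, integral_exp_neg_Ioi]
  simp

theorem integrable_expDensity_mul_eulerFace (ε a : ℝ) (k : ℤ) :
    Integrable fun s => expDensity s * eulerFace ε (a - s) (a + s) k := by
  unfold eulerFace
  split_ifs
  · exact integrable_expDensity_mul_eulerIcc _ _ _
  · simp only [mul_sub]
    exact ((integrable_expDensity_mul_eulerIcc _ _ _).sub
      (integrable_expDensity_mul_eulerIcc _ _ _)).sub (integrable_expDensity_mul_eulerIcc _ _ _)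

/-- The weight that the face of index `k` of the grid `ε ℤ` puts on either of its endpoints in the
weighting of the grid. It is determined by additivity from the weightings of one point, and of two
points at distance `ε`, whose weights are `1` and `(1 + exp (-ε))⁻¹`. A vertex has two endpoints
that coincide. -/
noncomputable def faceWeight (ε : ℝ) (k : ℤ) : ℝ :=
  if Even k then 1 / 2 else -(1 + Real.exp ε)⁻¹

theorem integral_expDensity_mul_eulerFace {ε : ℝ} (hε : 0 < ε) (j k : ℤ) :
    ∫ s, expDensity s * eulerFace ε (ε * j - s) (ε * j + s) k =
      faceWeight ε k * Real.exp (-|ε * j - ε * (k / 2 : ℤ)|) +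
      faceWeight ε k * Real.exp (-|ε * j - ε * ((k + 1) / 2 : ℤ)|) := by
  have hpt : ∀ m : ℤ, max (ε * m - ε * j) (ε * j - ε * m) = |ε * j - ε * m| := by
    intro m
    rw [max_comm, abs_eq_max_neg, neg_sub]
  obtain ⟨m, rfl | rfl⟩ := Int.even_or_odd' k
  · have h2 : 2 * m / 2 = m := by omega
    have h3 : (2 * m + 1) / 2 = m := by omega
    simp only [eulerFace_vertex]
    rw [integral_expDensity_mul_eulerIcc (hpt m) (abs_nonneg _), h2, h3, faceWeight,
      if_pos (even_two_mul m)]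
    ring
  · have h1 : ε * m ≤ ε * (m + 1 : ℤ) := by push_cast; nlinarith
    have hi := fun p q : ℝ => integrable_expDensity_mul_eulerIcc (ε * j) p q
    have h2 : (2 * m + 1) / 2 = m := by omega
    have h3 : (2 * m + 1 + 1) / 2 = m + 1 := by omega
    have hexp : Real.exp (-ε) * Real.exp ε = 1 := by rw [← Real.exp_add]; simp
    have hpos := Real.exp_pos ε
    simp only [eulerFace_edge, mul_sub]
    rw [integral_sub_sub (hi _ _) (hi _ _) (hi _ _),
      integral_expDensity_mul_eulerIcc (hpt m) (abs_nonneg _),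
      integral_expDensity_mul_eulerIcc (hpt (m + 1)) (abs_nonneg _), h2, h3, faceWeight,
      if_neg (by simp)]
    rcases le_or_gt j m with hjm | hjm
    · have h4 : ε * j ≤ ε * m := by
        have : (j : ℝ) ≤ m := by exact_mod_cast hjm
        gcongr
      rw [integral_expDensity_mul_eulerIcc (d := ε * m - ε * j) (max_eq_left (by linarith))
        (by linarith), abs_of_nonpos (by linarith), abs_of_nonpos (by linarith)]
      have h5 : -(-(ε * j - ε * (m + 1 : ℤ))) = -(-(ε * j - ε * m)) + -ε := by push_cast; ring
      rw [h5, Real.exp_add, neg_sub]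
      field_simp
      linear_combination -hexp
    · have h4 : ε * (m + 1 : ℤ) ≤ ε * j := by
        have : ((m + 1 : ℤ) : ℝ) ≤ j := by exact_mod_cast hjm
        gcongr
      rw [integral_expDensity_mul_eulerIcc (d := ε * j - ε * (m + 1 : ℤ))
        (max_eq_right (by linarith)) (by linarith), abs_of_nonneg (by linarith),
        abs_of_nonneg (by linarith)]
      have h5 : -(ε * j - ε * m) = -(ε * j - ε * (m + 1 : ℤ)) + -ε := by push_cast; ring
      rw [h5, Real.exp_add]
      field_simp
      linear_combination -hexp

/-- Summing the potentials of all faces of `A` at a vertex of `A` gives `1`: the exponential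
kernel is an average of indicator functions of boxes centred at the vertex, and each of these
boxes meets `A` in a set of Euler characteristic `1`. -/
theorem sum_prod_faceWeight {ε : ℝ} (hε : 0 < ε) {n : ℕ} (K : Finset (Fin n → ℤ))
    (hcomp : IsCompact {x : Fin n → ℝ | (fun i => faceIndex ε (x i)) ∈ K})
    (hconn : IsBoxConnected {x : Fin n → ℝ | (fun i => faceIndex ε (x i)) ∈ K})
    (J : Fin n → ℤ) (hJ : (fun i => 2 * J i) ∈ K) :
    ∑ k ∈ K, ∏ i, (faceWeight ε (k i) * Real.exp (-|ε * J i - ε * (k i / 2 : ℤ)|) +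
      faceWeight ε (k i) * Real.exp (-|ε * J i - ε * ((k i + 1) / 2 : ℤ)|)) = 1 := by
  classical
  simp only [← integral_expDensity_mul_eulerFace hε]
  rw [sum_prod_integral K (fun i k s => expDensity s * eulerFace ε (ε * J i - s) (ε * J i + s) k)
    fun i k => integrable_expDensity_mul_eulerFace _ _ _]
  have : ∀ s : Fin n → ℝ, ∑ k ∈ K, ∏ i, (expDensity (s i) *
      eulerFace ε (ε * J i - s i) (ε * J i + s i) (k i)) = ∏ i, expDensity (s i) := by
    intro s
    simp only [Finset.prod_mul_distrib]
    rw [← Finset.mul_sum]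
    by_cases hs : ∀ i, 0 ≤ s i
    · rw [sum_prod_eulerFace hε K hcomp hconn _ _ fun i => by linarith [hs i], if_pos, mul_one]
      refine ⟨fun i => ε * J i, ?_, fun i => ⟨by linarith [hs i], by linarith [hs i]⟩⟩
      simpa only [faceIndex_vertex hε] using hJ
    · push Not at hs
      obtain ⟨i, hi⟩ := hs
      rw [Finset.prod_eq_zero (Finset.mem_univ i), zero_mul]
      simp [expDensity, hi]
  simp only [this]
  rw [integral_fintype_prod_volume_eq_prod (fun _ => expDensity)]
  simp [integral_expDensity]

/-- The Steiner formula: the Euler characteristic of `A ∩ (x + [-r/2, r/2]ⁿ)` is the indicator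
function of the parallel body, and integrates to a sum over faces. -/
theorem volume_parallel_eq_sum {ε : ℝ} (hε : 0 < ε) {n : ℕ} (K : Finset (Fin n → ℤ))
    (hcomp : IsCompact {x : Fin n → ℝ | (fun i => faceIndex ε (x i)) ∈ K})
    (hconn : IsBoxConnected {x : Fin n → ℝ | (fun i => faceIndex ε (x i)) ∈ K})
    {r : ℝ} (hr : 0 ≤ r) :
    volume.real ({x : Fin n → ℝ | (fun i => faceIndex ε (x i)) ∈ K} +
        Set.Icc (fun _ => -(r / 2)) (fun _ => r / 2)) =
      ∑ k ∈ K, ∏ i, if Even (k i) then r else ε - r := by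
  classical
  have hset : ∀ x : Fin n → ℝ, x ∈ {x : Fin n → ℝ | (fun i => faceIndex ε (x i)) ∈ K} +
        Set.Icc (fun _ => -(r / 2)) (fun _ => r / 2) ↔
      ∃ y : Fin n → ℝ, (fun i => faceIndex ε (y i)) ∈ K ∧
        ∀ i, x i - r / 2 ≤ y i ∧ y i ≤ x i + r / 2 := by
    intro x
    constructor
    · rintro ⟨y, hy, z, hz, rfl⟩
      refine ⟨y, hy, fun i => ?_⟩
      have h1 : -(r / 2) ≤ z i := hz.1 i
      have h2 : z i ≤ r / 2 := hz.2 i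
      simp only [Pi.add_apply]
      constructor <;> linarith
    · rintro ⟨y, hy, hyx⟩
      refine ⟨y, hy, x - y, ⟨fun i => ?_, fun i => ?_⟩, by simp⟩ <;>
      · simp only [Pi.sub_apply]
        linarith [hyx i]
  simp only [← integral_eulerFace_sub_add hε hr]
  rw [sum_prod_integral K (fun _ k x => eulerFace ε (x - r / 2) (x + r / 2) k)
    fun _ k => integrable_eulerFace_sub_add _ _ _]
  have hmeas := (hcomp.add (isCompact_Icc (a := fun _ : Fin n => -(r / 2))
    (b := fun _ => r / 2))).measurableSet
  rw [← integral_indicator_one hmeas]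
  refine integral_congr_ae (Filter.Eventually.of_forall fun x => ?_)
  simp only
  rw [sum_prod_eulerFace hε K hcomp hconn _ _ fun i => by linarith, Set.indicator_apply]
  exact if_congr (hset x) rfl rfl

/-! ### Positive definiteness of `ℓ₁ⁿ` -/

/-- The function `m ↦ exp (-2 m)` on a finite set `T` of reals is strictly decreasing and positive,
hence a sum of positive numbers over the elements of `T` above `m`. -/
theorem exists_sum_ge_eq_exp (T : Finset ℝ) :
    ∃ g : ℝ → ℝ, (∀ u ∈ T, 0 < g u) ∧
      ∀ m ∈ T, ∑ u ∈ T with m ≤ u, g u = Real.exp (-2 * m) := by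
  induction T using Finset.induction_on_min with
  | empty => exact ⟨0, by simp⟩
  | insert a T ha ih =>
    obtain ⟨g, hg, hsum⟩ := ih
    have haT : a ∉ T := fun h => (ha a h).false
    have hlt : ∑ u ∈ T, g u < Real.exp (-2 * a) := by
      rcases T.eq_empty_or_nonempty with rfl | hne
      · simpa using Real.exp_pos _
      · have h1 : ∑ u ∈ T, g u = Real.exp (-2 * T.min' hne) := by
          rw [← hsum _ (T.min'_mem hne), Finset.filter_true_of_mem fun u hu => T.min'_le u hu]
        rw [h1, Real.exp_lt_exp]
        linarith [ha _ (T.min'_mem hne)]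
    have hcongr : ∀ S ⊆ T,
        ∑ u ∈ S, Function.update g a (Real.exp (-2 * a) - ∑ u ∈ T, g u) u = ∑ u ∈ S, g u := by
      intro S hS
      refine Finset.sum_congr rfl fun u hu => Function.update_of_ne ?_ _ _
      rintro rfl
      exact haT (hS hu)
    refine ⟨Function.update g a (Real.exp (-2 * a) - ∑ u ∈ T, g u), ?_, ?_⟩
    · intro u hu
      rcases eq_or_ne u a with rfl | hne
      · rw [Function.update_self]; linarith
      · rw [Function.update_of_ne hne]
        exact hg u (Finset.mem_of_mem_insert_of_ne hu hne)
    · intro m hm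
      rcases Finset.mem_insert.1 hm with rfl | hm
      · rw [Finset.filter_true_of_mem, Finset.sum_insert haT, hcongr T subset_rfl,
          Function.update_self]
        · ring
        · intro u hu
          rcases Finset.mem_insert.1 hu with rfl | hu
          · exact le_rfl
          · exact (ha u hu).le
      · rw [Finset.filter_insert, if_neg (not_le.2 (ha m hm)), hcongr _ (Finset.filter_subset _ _),
          hsum m hm]

theorem exp_neg_dist_eq_prod {n : ℕ} (x y : L1Space n) :
    Real.exp (-dist x y) = ∏ i, Real.exp (-|x i - y i|) := by
  rw [PiLp.dist_eq_of_L1, ← Finset.sum_neg_distrib, Real.exp_sum]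
  simp [Real.dist_eq]

/-- The quadratic form of the similarity matrix is a positive combination of squares. -/
theorem exists_sum_exp_neg_dist_eq {ι : Type*} [Fintype ι] {n : ℕ} (x : ι → L1Space n) :
    ∃ (G : Finset (Fin n → ℝ)) (g : (Fin n → ℝ) → ℝ), (∀ u ∈ G, 0 < g u) ∧
      (∀ b, (fun i => x b i) ∈ G) ∧
      ∀ c : ι → ℝ, ∑ a, ∑ b, c a * Real.exp (-dist (x a) (x b)) * c b =
        ∑ u ∈ G, g u * (∑ b, c b * ∏ i, if x b i ≤ u i then Real.exp (x b i) else 0) ^ 2 := by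
  classical
  let T : Finset ℝ := Finset.univ.biUnion fun b => Finset.univ.image fun i => x b i
  have hT : ∀ b i, x b i ∈ T := fun b i => by
    simp only [T, Finset.mem_biUnion, Finset.mem_image, Finset.mem_univ, true_and]
    exact ⟨b, i, rfl⟩
  obtain ⟨g, hg, hsum⟩ := exists_sum_ge_eq_exp T
  have h1 : ∀ s ∈ T, ∀ t ∈ T, Real.exp (-|s - t|) = ∑ u ∈ T, g u *
      ((if s ≤ u then Real.exp s else 0) * (if t ≤ u then Real.exp t else 0)) := by
    intro s hs t ht
    have hm : max s t ∈ T := by rcases max_choice s t with h | h <;> rw [h] <;> assumption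
    have h2 : -|s - t| = -2 * max s t + (s + t) := by
      rcases le_total s t with h | h
      · rw [max_eq_right h, abs_of_nonpos (by linarith)]; ring
      · rw [max_eq_left h, abs_of_nonneg (by linarith)]; ring
    rw [h2, Real.exp_add, Real.exp_add, ← hsum _ hm, Finset.sum_mul, Finset.sum_filter]
    refine Finset.sum_congr rfl fun u _ => ?_
    simp only [max_le_iff]
    split_ifs <;> simp_all
  refine ⟨Fintype.piFinset fun _ => T, fun u => ∏ i, g (u i), ?_, ?_, ?_⟩
  · intro u hu
    exact Finset.prod_pos fun i _ => hg _ (Fintype.mem_piFinset.1 hu i)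
  · intro b
    exact Fintype.mem_piFinset.2 fun i => hT b i
  · intro c
    have h2 : ∀ a b, c a * Real.exp (-dist (x a) (x b)) * c b =
        ∑ u ∈ Fintype.piFinset fun _ => T, (∏ i, g (u i)) *
          ((c a * ∏ i, if x a i ≤ u i then Real.exp (x a i) else 0) *
           (c b * ∏ i, if x b i ≤ u i then Real.exp (x b i) else 0)) := by
      intro a b
      rw [exp_neg_dist_eq_prod, Finset.prod_congr rfl fun i _ => h1 _ (hT a i) _ (hT b i),
        Finset.prod_univ_sum, Finset.mul_sum, Finset.sum_mul]
      refine Finset.sum_congr rfl fun u _ => ?_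
      rw [Finset.prod_mul_distrib, Finset.prod_mul_distrib]
      ring
    simp only [h2]
    rw [Finset.sum_congr rfl fun a _ => Finset.sum_comm, Finset.sum_comm]
    refine Finset.sum_congr rfl fun u _ => ?_
    rw [sq, Finset.sum_mul_sum, Finset.mul_sum]
    exact Finset.sum_congr rfl fun a _ => by rw [Finset.mul_sum]

theorem sum_exp_neg_dist_nonneg {ι : Type*} [Fintype ι] {n : ℕ} (x : ι → L1Space n) (c : ι → ℝ) :
    0 ≤ ∑ a, ∑ b, c a * Real.exp (-dist (x a) (x b)) * c b := by
  obtain ⟨G, g, hg, -, h⟩ := exists_sum_exp_neg_dist_eq x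
  rw [h]
  exact Finset.sum_nonneg fun u hu => mul_nonneg (hg u hu).le (sq_nonneg _)

theorem isPositiveDefinite_l1Space {n : ℕ} (A : Set (L1Space n)) : IsPositiveDefinite A := by
  intro B _
  refine Matrix.PosDef.of_dotProduct_mulVec_pos ?_ fun c hc => ?_
  · ext a b
    simp [similarityMatrix, dist_comm]
  have hQ : star c ⬝ᵥ (similarityMatrix B).mulVec c =
      ∑ a : B, ∑ b : B, c a * Real.exp (-dist (a : L1Space n) b) * c b := by
    simp only [dotProduct, Matrix.mulVec, similarityMatrix, Matrix.of_apply, Pi.star_apply,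
      star_trivial, Finset.mul_sum, mul_assoc]
  obtain ⟨G, g, hg, hG, h⟩ := exists_sum_exp_neg_dist_eq (fun b : B => (b : L1Space n))
  rw [hQ, h]
  -- only the point `b` itself, of least coordinate sum, contributes to the square indexed by `b`
  have hne : (Finset.univ.filter fun b => c b ≠ 0).Nonempty := by
    obtain ⟨b, hb⟩ := Function.ne_iff.1 hc
    exact ⟨b, by simpa using hb⟩
  obtain ⟨b, hb, hmin⟩ := Finset.exists_min_image _ (fun b : B => ∑ i, (b : L1Space n) i) hne
  rw [Finset.mem_filter] at hb
  refine Finset.sum_pos' (fun u hu => mul_nonneg (hg u hu).le (sq_nonneg _)) ⟨_, hG b, ?_⟩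
  refine mul_pos (hg _ (hG b)) (sq_pos_of_ne_zero ?_)
  rw [Finset.sum_eq_single b]
  · simpa [Finset.prod_eq_zero_iff] using hb.2
  · intro b' _ hbb'
    by_cases hc' : c b' = 0
    · rw [hc', zero_mul]
    have : ∃ i, (b : L1Space n) i < (b' : L1Space n) i := by
      by_contra! hle
      have hsum := hmin b' (by simpa using hc')
      have heq := (Finset.sum_eq_sum_iff_of_le fun i _ => hle i).1
        (le_antisymm (Finset.sum_le_sum fun i _ => hle i) hsum)
      apply hbb'
      ext i
      exact heq i (Finset.mem_univ i)
    obtain ⟨i, hi⟩ := this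
    rw [Finset.prod_eq_zero (Finset.mem_univ i) (if_neg (not_le.2 hi)), mul_zero]
  · simp

/-! ### Finite magnitudes -/

theorem finiteMagnitude_eq {X : Type*} [MetricSpace X] {B : Finset X} {w : B → ℝ}
    (hw : IsWeighting B w) : finiteMagnitude B = ∑ b, w b := by
  have h : ∃ w : B → ℝ, IsWeighting B w := ⟨w, hw⟩
  rw [finiteMagnitude, dif_pos h]
  exact h.choose_spec.sum_eq hw

theorem exists_isWeighting {X : Type*} [MetricSpace X] {B : Finset X}
    (hB : (similarityMatrix B).PosDef) : ∃ w : B → ℝ, IsWeighting B w := by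
  classical
  refine ⟨(similarityMatrix B)⁻¹.mulVec 1, fun a => ?_⟩
  have h : (similarityMatrix B).mulVec ((similarityMatrix B)⁻¹.mulVec 1) = 1 := by
    rw [Matrix.mulVec_mulVec,
      Matrix.mul_nonsing_inv _ ((Matrix.isUnit_iff_isUnit_det _).1 hB.isUnit), Matrix.one_mulVec]
  exact congrFun h a

/-- The magnitude of a finite set can be computed from a weighting given as a family of weighted
points, which may contain repetitions. -/
theorem finiteMagnitude_image {X : Type*} [MetricSpace X] [DecidableEq X] {κ : Type*} [Fintype κ]
    (x : κ → X) (c : κ → ℝ) (h : ∀ p, ∑ q, c q * Real.exp (-dist (x p) (x q)) = 1) :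
    finiteMagnitude (Finset.univ.image x) = ∑ q, c q := by
  have hsum : ∀ f : X → ℝ, ∑ b : (Finset.univ.image x : Finset X),
      f b * (∑ q with x q = b, c q) = ∑ q, c q * f (x q) := by
    intro f
    rw [Finset.sum_coe_sort (Finset.univ.image x) fun b => f b * ∑ q with x q = b, c q,
      ← Finset.sum_fiberwise_of_maps_to fun q hq => Finset.mem_image_of_mem x hq]
    refine Finset.sum_congr rfl fun b _ => ?_
    rw [Finset.mul_sum]
    refine Finset.sum_congr rfl fun q hq => ?_
    rw [(Finset.mem_filter.1 hq).2, mul_comm]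
  rw [finiteMagnitude_eq (w := fun b => ∑ q with x q = (b : X), c q)]
  · simpa using hsum 1
  · rintro ⟨a, ha⟩
    obtain ⟨p, -, rfl⟩ := Finset.mem_image.1 ha
    rw [← h p, ← hsum fun b => Real.exp (-dist (x p) b)]
    rfl

/-- Positivity of the energy of the difference of the two weighted families, of which `c` is a
weighting with respect to all points involved. -/
theorem two_mul_sum_le {ι κ : Type*} [Fintype ι] [Fintype κ] {n : ℕ} (y : ι → L1Space n)
    (w : ι → ℝ) (x : κ → L1Space n) (c : κ → ℝ)
    (hy : ∀ b, ∑ q, c q * Real.exp (-dist (y b) (x q)) = 1)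
    (hx : ∀ p, ∑ q, c q * Real.exp (-dist (x p) (x q)) = 1) :
    2 * ∑ b, w b ≤ (∑ a, ∑ b, w a * Real.exp (-dist (y a) (y b)) * w b) + ∑ q, c q := by
  have h := sum_exp_neg_dist_nonneg (Sum.elim y x) (Sum.elim w (-c))
  simp only [Fintype.sum_sum_type, Sum.elim_inl, Sum.elim_inr, Finset.sum_add_distrib,
    Pi.neg_apply] at h
  have h1 : ∑ b, ∑ q, w b * Real.exp (-dist (y b) (x q)) * -c q = -∑ b, w b := by
    rw [← Finset.sum_neg_distrib]
    refine Finset.sum_congr rfl fun b _ => ?_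
    conv_rhs => rw [← mul_one (w b), ← hy b, Finset.mul_sum, ← Finset.sum_neg_distrib]
    refine Finset.sum_congr rfl fun q _ => ?_
    ring
  have h2 : ∑ q, ∑ b, -c q * Real.exp (-dist (x q) (y b)) * w b = -∑ b, w b := by
    rw [← h1, Finset.sum_comm]
    refine Finset.sum_congr rfl fun b _ => Finset.sum_congr rfl fun q _ => ?_
    rw [dist_comm]
    ring
  have h3 : ∑ p, ∑ q, -c p * Real.exp (-dist (x p) (x q)) * -c q = ∑ q, c q := by
    refine Finset.sum_congr rfl fun p _ => ?_
    conv_rhs => rw [← mul_one (c p), ← hx p, Finset.mul_sum]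
    refine Finset.sum_congr rfl fun q _ => ?_
    ring
  rw [h1, h2, h3] at h
  linarith

open Filter Topology in
/-- Approximation of the magnitude of `A` from weighted families `(x N, c N)` of points of `A`.
They bound the magnitude from below. They also bound it from above, provided that every
point `a` of `A` is a limit of points `ρ N a` at which the weighting equation holds: the weighting
of a finite subset of `A`, moved along `ρ N`, is compared with `c N`. -/
theorem magnitude_eq_of_tendsto {n : ℕ} {A : Set (L1Space n)} {κ : ℕ → Type*}
    [∀ N, Fintype (κ N)] (x : ∀ N, κ N → L1Space n) (c : ∀ N, κ N → ℝ)
    (ρ : ℕ → L1Space n → L1Space n) (hρ : ∀ a, Tendsto (fun N => ρ N a) atTop (𝓝 a))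
    (hxA : ∀ᶠ N in atTop, ∀ q, x N q ∈ A)
    (hx : ∀ᶠ N in atTop, ∀ p, ∑ q, c N q * Real.exp (-dist (x N p) (x N q)) = 1)
    (hy : ∀ᶠ N in atTop, ∀ a ∈ A, ∑ q, c N q * Real.exp (-dist (ρ N a) (x N q)) = 1)
    {v : ℝ} (hv : Tendsto (fun N => ∑ q, c N q) atTop (𝓝 v)) :
    magnitude A = v := by
  classical
  apply le_antisymm
  · refine iSup₂_le fun B hB => EReal.coe_le_coe_iff.2 ?_
    obtain ⟨w, hw⟩ := exists_isWeighting (isPositiveDefinite_l1Space A B hB)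
    rw [finiteMagnitude_eq hw]
    have henergy : Tendsto (fun N => ∑ a : B, ∑ b : B, w a *
        Real.exp (-dist (ρ N (a : L1Space n)) (ρ N b)) * w b)
        atTop (𝓝 (∑ a : B, ∑ b : B, w a * Real.exp (-dist (a : L1Space n) b) * w b)) := by
      refine tendsto_finsetSum _ fun a _ => tendsto_finsetSum _ fun b _ => ?_
      refine (Tendsto.const_mul _ ?_).mul_const _
      exact (Real.continuous_exp.tendsto _).comp ((hρ _).dist (hρ _)).neg
    have hself : ∑ a : B, ∑ b : B, w a * Real.exp (-dist (a : L1Space n) b) * w b = ∑ b, w b := by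
      refine Finset.sum_congr rfl fun a _ => ?_
      conv_rhs => rw [← mul_one (w a), ← hw a, Finset.mul_sum]
      exact Finset.sum_congr rfl fun b _ => mul_assoc _ _ _
    rw [hself] at henergy
    have hle : 2 * ∑ b, w b ≤ ∑ b, w b + v := by
      refine ge_of_tendsto (henergy.add hv) ?_
      filter_upwards [hx, hy] with N hxN hyN
      exact two_mul_sum_le _ w (x N) (c N) (fun b => hyN b (hB b.2)) hxN
    linarith
  · refine le_of_tendsto ((continuous_coe_real_ereal.tendsto _).comp hv) ?_
    filter_upwards [hx, hxA] with N hxN hxAN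
    rw [Function.comp_apply, ← finiteMagnitude_image (x N) (c N) hxN]
    refine le_iSup₂_of_le (Finset.univ.image (x N)) ?_ le_rfl
    intro a ha
    obtain ⟨q, -, rfl⟩ := Finset.mem_image.1 (Finset.mem_coe.1 ha)
    exact hxAN q

/-! ### The weighting of a grid -/

/-- A vertex of the closure of the face of index `k` of the grid `ε ℤⁿ`: in each coordinate `σ`
selects one of the two endpoints. -/
noncomputable def faceVertex {n : ℕ} (ε : ℝ) (k : Fin n → ℤ) (σ : Fin n → Bool) : L1Space n :=
  WithLp.toLp 1 fun i => ε * ((k i + if σ i then 1 else 0) / 2 : ℤ)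

/-- A set `K` of face indices contains all vertices of its faces: the vertex `ε * J`, of index
`2 * J`, lies in the closure of the face of index `k` if and only if `|2 * J i - k i| ≤ 1` for
all `i`. -/
def VertexClosed {n : ℕ} (K : Finset (Fin n → ℤ)) : Prop :=
  ∀ k ∈ K, ∀ J : Fin n → ℤ, (∀ i, 2 * J i ≤ k i + 1 ∧ k i ≤ 2 * J i + 1) →
    (fun i => 2 * J i) ∈ K

theorem VertexClosed.floor_mem {n : ℕ} {K : Finset (Fin n → ℤ)} (hK : VertexClosed K)
    {k : Fin n → ℤ} (hk : k ∈ K) (σ : Fin n → Bool) :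
    (fun i => 2 * ((k i + if σ i then 1 else 0) / 2)) ∈ K := by
  refine hK k hk _ fun i => ?_
  split_ifs <;> omega

theorem sum_faceWeight_exp_neg_dist {ε : ℝ} (hε : 0 < ε) {n : ℕ} (K : Finset (Fin n → ℤ))
    (hcomp : IsCompact {x : Fin n → ℝ | (fun i => faceIndex ε (x i)) ∈ K})
    (hconn : IsBoxConnected {x : Fin n → ℝ | (fun i => faceIndex ε (x i)) ∈ K})
    (J : Fin n → ℤ) (hJ : (fun i => 2 * J i) ∈ K) :
    ∑ q : K × (Fin n → Bool), (∏ i, faceWeight ε ((q.1 : Fin n → ℤ) i)) *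
      Real.exp (-dist (WithLp.toLp 1 fun i => ε * J i : L1Space n) (faceVertex ε q.1 q.2)) = 1 := by
  rw [← sum_prod_faceWeight hε K hcomp hconn J hJ, Fintype.sum_prod_type,
    Finset.sum_coe_sort K fun k => ∑ σ : Fin n → Bool, (∏ i, faceWeight ε (k i)) *
      Real.exp (-dist (WithLp.toLp 1 fun i => ε * J i : L1Space n) (faceVertex ε k σ))]
  refine Finset.sum_congr rfl fun k _ => ?_
  have h : ∀ i, faceWeight ε (k i) * Real.exp (-|ε * J i - ε * (k i / 2 : ℤ)|) +
      faceWeight ε (k i) * Real.exp (-|ε * J i - ε * ((k i + 1) / 2 : ℤ)|) =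
      ∑ b : Bool, faceWeight ε (k i) *
        Real.exp (-|ε * J i - ε * ((k i + if b then 1 else 0) / 2 : ℤ)|) := by
    intro i
    rw [Fintype.sum_bool, add_comm]
    simp
  simp only [h]
  rw [Finset.prod_univ_sum, Fintype.piFinset_univ]
  refine Finset.sum_congr rfl fun σ _ => ?_
  rw [Finset.prod_mul_distrib, exp_neg_dist_eq_prod]
  rfl

/-- The total mass of the weighting of the grid is a value of the Steiner polynomial. -/
theorem sum_prod_faceWeight_mul_pow {ε r : ℝ} (hε : 0 < ε) {n : ℕ} (K : Finset (Fin n → ℤ))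
    (hr : r = ε * (Real.exp ε + 1) / (Real.exp ε - 1)) :
    (∑ q : K × (Fin n → Bool), ∏ i, faceWeight ε ((q.1 : Fin n → ℤ) i)) * r ^ n =
      ∑ k ∈ K, ∏ i, if Even (k i) then r else ε - r := by
  rw [Fintype.sum_prod_type, Finset.sum_coe_sort K fun k =>
    ∑ _σ : Fin n → Bool, ∏ i, faceWeight ε (k i), Finset.sum_mul]
  refine Finset.sum_congr rfl fun k _ => ?_
  have hconst : ∀ s : ℝ, s ^ n = ∏ _i : Fin n, s := fun s => by simp
  rw [Finset.sum_const, Finset.card_univ, Fintype.card_pi_const, Fintype.card_bool, nsmul_eq_mul,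
    Nat.cast_pow, Nat.cast_ofNat, hconst, hconst, ← Finset.prod_mul_distrib,
    ← Finset.prod_mul_distrib]
  refine Finset.prod_congr rfl fun i _ => ?_
  have h1 : 0 < Real.exp ε - 1 := by linarith [Real.add_one_lt_exp hε.ne']
  have h2 : 0 < Real.exp ε + 1 := by linarith
  have h3 : 0 < 1 + Real.exp ε := by linarith
  unfold faceWeight
  split_ifs
  · ring
  · rw [hr]
    field_simp
    ring

/-! ### Pixelated sets -/

/-- The faces of the grid `(c / N) ℤⁿ` in the union of the pixels `c • pixel a` for `a ∈ F`. -/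
noncomputable def pixelFaces {n : ℕ} (N : ℕ) (F : Finset (Fin n → ℤ)) : Finset (Fin n → ℤ) :=
  F.biUnion fun a => Finset.Icc (fun i => 2 * (N * a i)) (fun i => 2 * (N * (a i + 1)))

theorem faceIndex_mem_pixelFaces {n N : ℕ} (hN : 0 < N) {c : ℝ} (hc : 0 < c)
    (F : Finset (Fin n → ℤ)) (x : Fin n → ℝ) :
    (fun i => faceIndex (c / N) (x i)) ∈ pixelFaces N F ↔
      ∃ a ∈ F, ∀ i, c * a i ≤ x i ∧ x i ≤ c * (a i + 1) := by
  have hN' : (0 : ℝ) < N := by exact_mod_cast hN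
  have h1 : ∀ m : ℤ, c / N * (N * m : ℤ) = c * m := fun m => by
    push_cast
    field_simp
  simp only [pixelFaces, Finset.mem_biUnion, Finset.mem_Icc, Pi.le_def,
    two_mul_le_faceIndex (div_pos hc hN'), faceIndex_le_two_mul (div_pos hc hN'), h1, forall_and,
    Int.cast_add, Int.cast_one]

theorem vertexClosed_pixelFaces {n : ℕ} (N : ℕ) (F : Finset (Fin n → ℤ)) :
    VertexClosed (pixelFaces N F) := by
  intro k hk J hJ
  simp only [pixelFaces, Finset.mem_biUnion, Finset.mem_Icc, Pi.le_def] at hk ⊢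
  obtain ⟨a, ha, h1, h2⟩ := hk
  refine ⟨a, ha, fun i => ?_, fun i => ?_⟩
  · have := h1 i
    have := hJ i
    omega
  · have := h2 i
    have := hJ i
    omega

theorem mem_smul_biUnion_pixel {n : ℕ} {c : ℝ} (hc : 0 < c) (F : Finset (Fin n → ℤ))
    (x : L1Space n) : x ∈ c • ⋃ a ∈ F, pixel a ↔
      ∃ a ∈ F, ∀ i, c * a i ≤ x i ∧ x i ≤ c * (a i + 1) := by
  rw [Set.mem_smul_set_iff_inv_smul_mem₀ hc.ne']
  simp only [Set.mem_iUnion, pixel, Set.mem_ofPred_eq, Set.mem_Icc, PiLp.smul_apply, smul_eq_mul,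
    exists_prop, le_inv_mul_iff₀ hc, inv_mul_le_iff₀ hc]

theorem isCompact_pixelFaces {n N : ℕ} (hN : 0 < N) {c : ℝ} (hc : 0 < c)
    (F : Finset (Fin n → ℤ)) :
    IsCompact {x : Fin n → ℝ | (fun i => faceIndex (c / N) (x i)) ∈ pixelFaces N F} := by
  have : {x : Fin n → ℝ | (fun i => faceIndex (c / N) (x i)) ∈ pixelFaces N F} =
      ⋃ a ∈ F, Set.Icc (fun i => c * a i) (fun i => c * (a i + 1)) := by
    ext x
    simp only [Set.mem_ofPred_eq, faceIndex_mem_pixelFaces hN hc, Set.mem_iUnion, Set.mem_Icc,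
      Pi.le_def, forall_and, exists_prop]
  rw [this]
  exact F.isCompact_biUnion fun a _ => isCompact_Icc

theorem abs_sub_apply_le_dist {n : ℕ} (x y : L1Space n) (i : Fin n) :
    |x i - y i| ≤ dist x y := by
  rw [PiLp.dist_eq_of_L1, ← Real.dist_eq]
  exact Finset.single_le_sum (f := fun i => dist (x i) (y i)) (fun _ _ => dist_nonneg)
    (Finset.mem_univ i)

/-- Geodesics of `ℓ₁ⁿ` are monotone in every coordinate. -/
theorem IsGeodesic.isBoxConnected {n : ℕ} {A : Set (L1Space n)} (hA : IsGeodesic A) :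
    IsBoxConnected {x : Fin n → ℝ | WithLp.toLp 1 x ∈ A} := by
  intro a ha b hb i t ht
  obtain ⟨γ, h0, h1, hγA, hγ⟩ := hA _ ha _ hb
  set D := dist (WithLp.toLp 1 a : L1Space n) (WithLp.toLp 1 b) with hD
  have hD0 : 0 ≤ D := dist_nonneg
  have hcont : ContinuousOn (fun s => γ s i) (Set.uIcc 0 D) := by
    rw [Set.uIcc_of_le hD0]
    refine (LipschitzOnWith.of_dist_le_mul (K := 1) fun s hs s' hs' => ?_).continuousOn
    rw [NNReal.coe_one, one_mul, ← hγ s hs s' hs', Real.dist_eq]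
    exact abs_sub_apply_le_dist _ _ _
  have himage := intermediate_value_uIcc hcont
  rw [h0, h1] at himage
  obtain ⟨s, hs, hst⟩ := himage ht
  rw [Set.uIcc_of_le hD0] at hs
  refine ⟨γ s, hγA s hs, hst, fun j => ?_⟩
  have hsum : dist (γ 0) (γ s) + dist (γ s) (γ D) = dist (γ 0) (γ D) := by
    rw [hγ 0 ⟨le_rfl, hD0⟩ s hs, hγ s hs D ⟨hD0, le_rfl⟩, hγ 0 ⟨le_rfl, hD0⟩ D ⟨hD0, le_rfl⟩,
      Real.dist_eq, Real.dist_eq, Real.dist_eq, abs_of_nonpos (by linarith [hs.1]),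
      abs_of_nonpos (by linarith [hs.2]), abs_of_nonpos (by linarith)]
    ring
  rw [h0, h1] at hsum
  simp only [PiLp.dist_eq_of_L1] at hsum
  rw [← Finset.sum_add_distrib] at hsum
  have heq := (Finset.sum_eq_sum_iff_of_le fun j _ => dist_triangle (a j) (γ s j) (b j)).1
    hsum.symm j (Finset.mem_univ j)
  rw [Real.dist_eq, Real.dist_eq, Real.dist_eq] at heq
  rw [Set.mem_uIcc]
  grind

/-! ### The Steiner polynomial -/

theorem vol_add_smul_cube {n : ℕ} (A : Set (L1Space n)) {r : ℝ} (hr : 0 ≤ r) :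
    vol (A + r • cube n) = MeasureTheory.volume.real ({x : Fin n → ℝ | WithLp.toLp 1 x ∈ A} +
      Set.Icc (fun _ => -(r / 2)) (fun _ => r / 2)) := by
  rw [vol]
  congr 1
  ext x
  constructor
  · rintro ⟨_, ⟨y, hy, _, ⟨z, hz, rfl⟩, rfl⟩, rfl⟩
    refine ⟨fun i => y i, hy, fun i => r * z i, ⟨fun i => ?_, fun i => ?_⟩, rfl⟩
    · have := (hz i).1
      simp only
      nlinarith
    · have := (hz i).2
      simp only
      nlinarith
  · rintro ⟨y, hy, z, hz, rfl⟩
    refine ⟨_, ⟨_, hy, WithLp.toLp 1 z, ?_, rfl⟩, rfl⟩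
    rcases hr.eq_or_lt with rfl | hr
    · refine ⟨0, fun i => ?_, ?_⟩
      · simp only [PiLp.zero_apply]
        norm_num
      · ext i
        have h1 := hz.1 i
        have h2 := hz.2 i
        simp only at h1 h2
        simp only [zero_smul, PiLp.zero_apply]
        linarith
    · rw [Set.mem_smul_set_iff_inv_smul_mem₀ hr.ne']
      intro i
      have h1 := hz.1 i
      have h2 := hz.2 i
      simp only at h1 h2
      rw [PiLp.smul_apply, smul_eq_mul, Set.mem_Icc, le_inv_mul_iff₀ hr, inv_mul_le_iff₀ hr]
      constructor <;> linarith

theorem exists_coeff_sum_prod {n : ℕ} (ε : ℝ) (K : Finset (Fin n → ℤ)) :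
    ∃ V : Fin (n + 1) → ℝ, ∀ r : ℝ, (∑ k ∈ K, ∏ i, if Even (k i) then r else ε - r) =
      ∑ i : Fin (n + 1), V i * r ^ (n - (i : ℕ)) := by
  let p : Polynomial ℝ := ∑ k ∈ K, ∏ i : Fin n,
    if Even (k i) then Polynomial.X else Polynomial.C ε - Polynomial.X
  have hp : p.natDegree < n + 1 := by
    refine Nat.lt_succ_of_le (Polynomial.natDegree_sum_le_of_forall_le _ _ fun k _ => ?_)
    refine (Polynomial.natDegree_prod_le _ _).trans ?_
    refine (Finset.sum_le_card_nsmul _ _ 1 fun i _ => ?_).trans (by simp)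
    split_ifs
    · exact Polynomial.natDegree_X_le
    · exact (Polynomial.natDegree_sub_le _ _).trans (by simp)
  refine ⟨fun i => p.coeff (n - i), fun r => ?_⟩
  have h1 : (∑ k ∈ K, ∏ i, if Even (k i) then r else ε - r) = p.eval r := by
    simp only [p, Polynomial.eval_finsetSum, Polynomial.eval_prod]
    refine Finset.sum_congr rfl fun k _ => Finset.prod_congr rfl fun i _ => ?_
    split_ifs <;> simp
  rw [h1, Polynomial.eval_eq_sum_range' hp,
    Fin.sum_univ_eq_sum_range (fun i => p.coeff (n - i) * r ^ (n - i)) (n + 1)]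
  exact (Finset.sum_range_reflect (fun i => p.coeff i * r ^ i) (n + 1)).symm

theorem isSteinerCoeff_l1IntrinsicVolume {n : ℕ} {A : Set (L1Space n)}
    (h : ∃ V, IsSteinerCoeff A V) : IsSteinerCoeff A (l1IntrinsicVolume A) := by
  rw [l1IntrinsicVolume, dif_pos h]
  exact h.choose_spec

/-! ### Refining the grid -/

open Filter Topology

/-- The parameter at which the Steiner polynomial computes the magnitude of a grid of mesh `ε`
tends to `2`. -/
theorem tendsto_steinerParameter :
    Tendsto (fun ε => ε * (Real.exp ε + 1) / (Real.exp ε - 1)) (𝓝[>] 0) (𝓝 2) := by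
  have h1 : Tendsto (fun ε : ℝ => ε⁻¹ * (Real.exp ε - 1)) (𝓝[>] 0) (𝓝 1) := by
    have := hasDerivAt_iff_tendsto_slope_zero.1 (Real.hasDerivAt_exp 0)
    simp only [zero_add, Real.exp_zero, smul_eq_mul] at this
    exact this.mono_left (nhdsWithin_mono _ fun x hx => ne_of_gt hx)
  have h2 : Tendsto (fun ε : ℝ => Real.exp ε + 1) (𝓝[>] 0) (𝓝 2) := by
    have : Tendsto (fun ε : ℝ => Real.exp ε + 1) (𝓝 0) (𝓝 (Real.exp 0 + 1)) :=
      (Real.continuous_exp.add continuous_const).tendsto 0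
    rw [Real.exp_zero, one_add_one_eq_two] at this
    exact this.mono_left nhdsWithin_le_nhds
  have h3 := h2.div h1 one_ne_zero
  rw [div_one] at h3
  refine h3.congr fun ε => ?_
  simp only [Pi.div_apply]
  rw [inv_mul_eq_div, div_div_eq_mul_div, mul_comm]

/-- The largest vertex of the grid `ε ℤⁿ` below `x`. -/
noncomputable def gridRound {n : ℕ} (ε : ℝ) (x : L1Space n) : L1Space n :=
  WithLp.toLp 1 fun i => ε * (⌊x i / ε⌋ : ℤ)

theorem tendsto_gridRound {n : ℕ} (x : L1Space n) :
    Tendsto (fun ε => gridRound ε x) (𝓝[>] 0) (𝓝 x) := by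
  refine ((PiLp.continuous_toLp 1 fun _ : Fin n => ℝ).tendsto (fun i => x i)).comp ?_
  rw [tendsto_pi_nhds]
  intro i
  have hlow : Tendsto (fun ε : ℝ => x i - ε) (𝓝[>] 0) (𝓝 (x i)) := by
    have : Tendsto (fun ε : ℝ => x i - ε) (𝓝 0) (𝓝 (x i - 0)) :=
      (continuous_const.sub continuous_id).tendsto 0
    rw [sub_zero] at this
    exact this.mono_left nhdsWithin_le_nhds
  refine tendsto_of_tendsto_of_tendsto_of_le_of_le' hlow tendsto_const_nhds ?_ ?_
  · filter_upwards [self_mem_nhdsWithin] with ε hε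
    have hε : 0 < ε := hε
    have h := (Int.lt_floor_add_one (x i / ε)).le
    rw [div_le_iff₀ hε] at h
    linarith
  · filter_upwards [self_mem_nhdsWithin] with ε hε
    have hε : 0 < ε := hε
    have h := Int.floor_le (x i / ε)
    rw [le_div_iff₀ hε] at h
    linarith

theorem VertexClosed.gridRound_mem {n : ℕ} {K : Finset (Fin n → ℤ)} (hK : VertexClosed K) {ε : ℝ}
    {x : L1Space n} (hx : (fun i => faceIndex ε (x i)) ∈ K) :
    (fun i => 2 * ⌊x i / ε⌋) ∈ K := by
  refine hK _ hx _ fun i => ?_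
  have h1 := Int.floor_le_ceil (x i / ε)
  have h2 := Int.ceil_le_floor_add_one (x i / ε)
  rw [faceIndex]
  constructor <;> omega

end L1Magnitude

open L1Magnitude Filter Topology

/-- Every `ℓ₁`-convex pixelated `A ⊆ ℓ₁ⁿ` is positive definite and has a Steiner polynomial
(so that its magnitude and its `ℓ₁`-intrinsic volumes are meaningful), and its magnitude is
`∑ i, 2⁻ⁱ V'_i(A)`. -/
theorem mainTheorem2 (n : ℕ) (A : Set (L1Magnitude.L1Space n))
    (hpix : L1Magnitude.IsPixelated A) (hconv : L1Magnitude.IsGeodesic A) :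
    L1Magnitude.IsPositiveDefinite A ∧
    L1Magnitude.IsSteinerCoeff A (L1Magnitude.l1IntrinsicVolume A) ∧
    L1Magnitude.magnitude A =
      ((∑ i : Fin (n + 1), L1Magnitude.l1IntrinsicVolume A i / 2 ^ (i : ℕ) : ℝ) : EReal) := by
  classical
  obtain ⟨c, hc, F, hA⟩ := hpix
  have hmem : ∀ N : ℕ, 0 < N → ∀ x : Fin n → ℝ,
      (fun i => faceIndex (c / N) (x i)) ∈ pixelFaces N F ↔ WithLp.toLp 1 x ∈ A := by
    intro N hN x
    rw [faceIndex_mem_pixelFaces hN hc, hA, mem_smul_biUnion_pixel hc]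
  have hset : ∀ N : ℕ, 0 < N → {x : Fin n → ℝ | (fun i => faceIndex (c / N) (x i)) ∈
      pixelFaces N F} = {x | WithLp.toLp 1 x ∈ A} := fun N hN => Set.ext (hmem N hN)
  have hcomp := fun (N : ℕ) (hN : 0 < N) => isCompact_pixelFaces hN hc F
  have hconn : ∀ N : ℕ, 0 < N →
      IsBoxConnected {x : Fin n → ℝ | (fun i => faceIndex (c / N) (x i)) ∈ pixelFaces N F} := by
    intro N hN
    rw [hset N hN]
    exact hconv.isBoxConnected
  have hpos : ∀ N : ℕ, 0 < N → 0 < c / N := fun N hN => div_pos hc (by exact_mod_cast hN)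
  have hvol : ∀ N : ℕ, 0 < N → ∀ r : ℝ, 0 ≤ r → vol (A + r • cube n) =
      ∑ k ∈ pixelFaces N F, ∏ i, if Even (k i) then r else c / N - r := by
    intro N hN r hr
    rw [vol_add_smul_cube A hr, ← hset N hN,
      volume_parallel_eq_sum (hpos N hN) _ (hcomp N hN) (hconn N hN) hr]
  have hsteiner : IsSteinerCoeff A (l1IntrinsicVolume A) := by
    apply isSteinerCoeff_l1IntrinsicVolume
    obtain ⟨V, hV⟩ := exists_coeff_sum_prod (c / (1 : ℕ)) (pixelFaces 1 F)
    exact ⟨V, fun r hr => (hvol 1 one_pos r hr).trans (hV r)⟩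
  refine ⟨isPositiveDefinite_l1Space A, hsteiner, ?_⟩
  set V := l1IntrinsicVolume A
  -- the mesh of the grid and the parameter of its Steiner polynomial
  let mesh : ℕ → ℝ := fun N => c / N
  let r : ℝ → ℝ := fun ε => ε * (Real.exp ε + 1) / (Real.exp ε - 1)
  have hmesh : Tendsto mesh atTop (𝓝[>] 0) := by
    refine tendsto_nhdsWithin_iff.2 ⟨tendsto_const_div_atTop_nhds_zero_nat c, ?_⟩
    filter_upwards [eventually_gt_atTop 0] with N hN
    exact hpos N hN
  let M : ℕ → ℝ := fun N => ∑ q : pixelFaces N F × (Fin n → Bool),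
    ∏ i, faceWeight (mesh N) ((q.1 : Fin n → ℤ) i)
  have hM : Tendsto M atTop (𝓝 (∑ i : Fin (n + 1), V i / 2 ^ (i : ℕ))) := by
    have hr : Tendsto (fun N => r (mesh N)) atTop (𝓝 2) := tendsto_steinerParameter.comp hmesh
    have hlim : Tendsto (fun N => ∑ i : Fin (n + 1), V i / r (mesh N) ^ (i : ℕ)) atTop
        (𝓝 (∑ i : Fin (n + 1), V i / 2 ^ (i : ℕ))) :=
      tendsto_finsetSum _ fun i _ => tendsto_const_nhds.div (hr.pow _) (by positivity)
    refine hlim.congr' ?_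
    filter_upwards [eventually_gt_atTop 0] with N hN
    have hε : 0 < mesh N := hpos N hN
    have h1 : 0 < Real.exp (mesh N) - 1 := by linarith [Real.add_one_lt_exp hε.ne']
    have hrpos : 0 < r (mesh N) := div_pos (mul_pos hε (by linarith)) h1
    have h2 := sum_prod_faceWeight_mul_pow hε (pixelFaces N F) (r := r (mesh N)) rfl
    rw [← hvol N hN _ hrpos.le, hsteiner _ hrpos.le] at h2
    rw [← mul_left_inj' (pow_pos hrpos n).ne', h2, Finset.sum_mul]
    refine Finset.sum_congr rfl fun i _ => ?_
    rw [pow_sub₀ _ hrpos.ne' (Nat.le_of_lt_succ i.2)]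
    field_simp
  have hweight : ∀ N : ℕ, 0 < N → ∀ J : Fin n → ℤ, (fun i => 2 * J i) ∈ pixelFaces N F →
      ∑ q : pixelFaces N F × (Fin n → Bool), (∏ i, faceWeight (mesh N) ((q.1 : Fin n → ℤ) i)) *
        Real.exp (-dist (WithLp.toLp 1 fun i => mesh N * J i : L1Space n)
          (faceVertex (mesh N) q.1 q.2)) = 1 := fun N hN J hJ =>
    sum_faceWeight_exp_neg_dist (hpos N hN) _ (hcomp N hN) (hconn N hN) J hJ
  refine magnitude_eq_of_tendsto (fun N (q : pixelFaces N F × (Fin n → Bool)) =>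
    faceVertex (mesh N) q.1 q.2) _ (fun N => gridRound (mesh N))
    (fun a => (tendsto_gridRound a).comp hmesh) ?_ ?_ ?_ hM
  · filter_upwards [eventually_gt_atTop 0] with N hN q
    refine (hmem N hN _).1 ?_
    have h := (vertexClosed_pixelFaces N F).floor_mem q.1.2 q.2
    simp only [← faceIndex_vertex (hpos N hN)] at h
    exact h
  · filter_upwards [eventually_gt_atTop 0] with N hN p
    exact hweight N hN _ ((vertexClosed_pixelFaces N F).floor_mem p.1.2 p.2)
  · filter_upwards [eventually_gt_atTop 0] with N hN a ha
    exact hweight N hN _ ((vertexClosed_pixelFaces N F).gridRound_mem ((hmem N hN _).2 ha))
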